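/- Let $X=(X_t)_{t\ge 0}$ be a spectrally positive Lévy process with $X_0=0$ on a probability space $(\Omega,\mathcal F,\mathbb P)$, i.e. a càdlàg real-valued process with stationary independent increments that has no negative jumps and is not a subordinator (its paths are not almost surely nondecreasing). Let $\mathbb F$ be the natural enlargement of the filtration generated by $X$: for each $t$ the $\sigma$-algebra generated by $X_s$, $s\le t$, is enlarged by all sets covered by countably many $\mathbb P$-null events each lying in some $\sigma(X_s : s\le u)$, $u<\infty$, and the resulting filtration is made right-continuous. Let $\mathcal T_{0,\infty}$ be the set of all $[0,\infty]$-valued $\mathbb F$-stopping times. For $x\in\mathbb R$ let $\mathbb E_x$ denote expectation for the process started at $x$, i.e. with $X$ replaced by $x+X$. Let $\alpha\ge 0$ and $\beta,q,K>0$, let $\psi(\theta)=\log\mathbb E[e^{-\theta X_1}]$, and assume $\psi(-1)<q$ (in particular $\mathbb E[e^{X_1}]<\infty$). Put $$L_t=e^{-qt+X_t}+\int_0^t e^{-qs}(\alpha+\beta e^{X_s})\,ds,\qquad U_t=e^{-qt}(e^{X_t}\vee K)+\int_0^t e^{-qs}(\alpha+\beta e^{X_s})\,ds,$$ with $L_\infty=U_\infty=\int_0^\infty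 e^{-qs}(\alpha+\beta e^{X_s})\,ds$, and for $\tau,\sigma\in\mathcal T_{0,\infty}$ $$M_x(\tau,\sigma)=\mathbb E_x\big[L_\tau \mathbf 1_{\{\tau<\sigma\}}+U_\sigma\mathbf 1_{\{\sigma\le\tau\}}\big]\in[0,\infty].$$ **Theorem.** Suppose $q\le\alpha/K$. Then for every $x\in\mathbb R$ a saddle point of the game is given by $\sigma^*=0$ and $\tau^*=\tau^+_{\log K}$, where $\tau^+_{\log K}=\inf\{t>0: X_t>\log K\}$ under $\mathbb P_x$ (i.e. $\inf\{t>0:x+X_t>\log K\}$, with $\inf\emptyset=\infty$). That is, $\tau^*,\sigma^*\in\mathcal T_{0,\infty}$ and $$M_x(\tau,\sigma^*)\le M_x(\tau^*,\sigma^*)\le M_x(\tau^*,\sigma)\qquad\text{for all }\tau,\sigma\in\mathcal T_{0,\infty}.$$ Moreover the game has the value $$V(x)=\sup_{\tau\in\mathcal T_{0,\infty}}\inf_{\sigma\in\mathcal T_{0,\infty}} M_x(\tau,\sigma)=\inf_{\sigma\in\mathcal T_{0,\infty}}\sup_{\tau\in\mathcal T_{0,\infty}} M_x(\tau,\sigma)=K\vee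 e^x .$$ -/

import Mathlib

open MeasureTheory ProbabilityTheory Set Filter Topology
open scoped NNReal ENNReal

namespace ConvertibleBond

/-! ### Spectrally positive Lévy processes -/

/-- A real-valued Lévy process on the probability space `(Ω, P)`, started at `0`: càdlàg paths,
stationary and independent increments. -/
structure IsLevyProcess {Ω : Type*} [MeasurableSpace Ω] (X : ℝ≥0 → Ω → ℝ) (P : Measure Ω) :
    Prop where
  measurable : ∀ t, Measurable (X t)
  zero : ∀ᵐ ω ∂P, X 0 ω = 0
  right_continuous : ∀ ω t, ContinuousWithinAt (fun s => X s ω) (Ici t) t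
  left_limits : ∀ ω t, ∃ l : ℝ, Tendsto (fun s => X s ω) (𝓝[<] t) (𝓝 l)
  indep_increments : HasIndepIncrements X P
  stationary_increments : ∀ s t : ℝ≥0, IdentDistrib (fun ω => X (s + t) ω - X s ω) (X t) P P

/-- A spectrally positive Lévy process: a Lévy process that almost surely has no negative jumps
and that is not a subordinator (a Lévy process whose paths are almost surely nondecreasing). -/
structure IsSpectrallyPositive {Ω : Type*} [MeasurableSpace Ω] (X : ℝ≥0 → Ω → ℝ)
    (P : Measure Ω) : Prop extends IsLevyProcess X P where
  no_negative_jumps : ∀ᵐ ω ∂P, ∀ t : ℝ≥0, 0 < t →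
    ∀ l : ℝ, Tendsto (fun s => X s ω) (𝓝[<] t) (𝓝 l) → l ≤ X t ω
  not_subordinator : ¬ ∀ᵐ ω ∂P, Monotone fun t => X t ω

/-- The Laplace exponent `ψ(θ) = log E[exp (-θ X₁)]`, equivalently
`E[exp (-θ X_t)] = exp (t ψ(θ))`. It takes the value `+∞` where `exp (-θ X₁)` is not
integrable. -/
noncomputable def laplaceExponent {Ω : Type*} [MeasurableSpace Ω] (X : ℝ≥0 → Ω → ℝ)
    (P : Measure Ω) (θ : ℝ) : EReal :=
  ENNReal.log (∫⁻ ω, ENNReal.ofReal (Real.exp (-θ * X 1 ω)) ∂P)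

/-! ### The naturally enlarged filtration -/

/-- The `σ`-algebra `σ(X_s : s ≤ t)` generated by the process up to time `t`. -/
@[reducible] def rawSigma {Ω : Type*} (X : ℝ≥0 → Ω → ℝ) (t : ℝ≥0) : MeasurableSpace Ω :=
  ⨆ s : ℝ≥0, ⨆ _ : s ≤ t, MeasurableSpace.comap (X s) inferInstance

/-- A set is nearly empty if it is covered by countably many `P`-null events, each of which
is determined by the process up to some finite time. -/
def IsNearlyEmpty {Ω : Type*} [MeasurableSpace Ω] (X : ℝ≥0 → Ω → ℝ) (P : Measure Ω)
    (N : Set Ω) : Prop :=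
  ∃ A : ℕ → Set Ω, (∀ n, (∃ t, MeasurableSet[rawSigma X t] (A n)) ∧ P (A n) = 0) ∧
    N ⊆ ⋃ n, A n

theorem rawSigma_le {Ω : Type*} {m : MeasurableSpace Ω} {X : ℝ≥0 → Ω → ℝ}
    (hX : ∀ t, Measurable (X t)) (t : ℝ≥0) : rawSigma X t ≤ m :=
  iSup₂_le fun s _ => (hX s).comap_le

theorem IsNearlyEmpty.measure_eq_zero {Ω : Type*} [MeasurableSpace Ω] {X : ℝ≥0 → Ω → ℝ}
    {P : Measure Ω} {N : Set Ω} (h : IsNearlyEmpty X P N) : P N = 0 := by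
  obtain ⟨A, hA, hN⟩ := h
  exact measure_mono_null hN (measure_iUnion_null fun n => (hA n).2)

/-- The filtration generated by the process, with all nearly empty sets adjoined at each time.
Its `σ`-algebras are contained in the `P`-completion of the `σ`-algebra of the space. -/
def regularizedFiltration {Ω : Type*} [m : MeasurableSpace Ω] (X : ℝ≥0 → Ω → ℝ)
    (hX : ∀ t, Measurable (X t)) (P : Measure Ω) :
    Filtration ℝ≥0 (eventuallyMeasurableSpace m (ae P)) where
  seq t := rawSigma X t ⊔ MeasurableSpace.generateFrom {N | IsNearlyEmpty X P N}
  mono' s t hst := by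
    refine sup_le_sup_right ?_ _
    exact iSup₂_le fun r hr =>
      le_iSup₂_of_le (f := fun (s : ℝ≥0) (_ : s ≤ t) => MeasurableSpace.comap (X s) inferInstance)
        r (hr.trans hst) le_rfl
  le' t := by
    refine sup_le (fun s hs => (rawSigma_le hX t s hs).nullMeasurableSet) ?_
    refine MeasurableSpace.generateFrom_le fun N hN => ?_
    exact NullMeasurableSet.of_null hN.measure_eq_zero

/-- The natural enlargement of the filtration generated by the process: the right-continuous
version of the regularized filtration. -/
noncomputable def naturalEnlargement {Ω : Type*} [m : MeasurableSpace Ω] (X : ℝ≥0 → Ω → ℝ)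
    (hX : ∀ t, Measurable (X t)) (P : Measure Ω) :
    Filtration ℝ≥0 (eventuallyMeasurableSpace m (ae P)) :=
  (regularizedFiltration X hX P).rightCont

/-! ### The game

The pay-offs are nonnegative, so they and their expectations are taken in `[0, ∞]`.
Times are taken in `WithTop ℝ≥0 = [0, ∞]`. -/

/-- The accumulated coupon `∫₀ᵗ e^{-qs} (α + β e^{y s}) ds` along a path `y`, for `t ∈ [0, ∞]`. -/
noncomputable def coupon (q α β : ℝ) (y : ℝ≥0 → ℝ) (t : WithTop ℝ≥0) : ℝ≥0∞ :=
  ∫⁻ s in {s : ℝ | 0 ≤ s ∧ (s.toNNReal : WithTop ℝ≥0) ≤ t},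
    ENNReal.ofReal (Real.exp (-q * s) * (α + β * Real.exp (y s.toNNReal)))

/-- The discounted terminal pay-off `e^{-qt} g(y t)`. It vanishes at `t = ∞`. -/
noncomputable def terminal (q : ℝ) (g : ℝ → ℝ) (y : ℝ≥0 → ℝ) : WithTop ℝ≥0 → ℝ≥0∞
  | ⊤ => 0
  | (t : ℝ≥0) => ENNReal.ofReal (Real.exp (-q * t) * g (y t))

/-- `L_t = e^{-qt + y t} + ∫₀ᵗ e^{-qs} (α + β e^{y s}) ds`. -/
noncomputable def payoffL (q α β : ℝ) (y : ℝ≥0 → ℝ) (t : WithTop ℝ≥0) : ℝ≥0∞ :=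
  terminal q (fun z => Real.exp z) y t + coupon q α β y t

/-- `U_t = e^{-qt} (e^{y t} ∨ K) + ∫₀ᵗ e^{-qs} (α + β e^{y s}) ds`. -/
noncomputable def payoffU (q α β K : ℝ) (y : ℝ≥0 → ℝ) (t : WithTop ℝ≥0) : ℝ≥0∞ :=
  terminal q (fun z => max (Real.exp z) K) y t + coupon q α β y t

open Classical in
/-- The expected pay-off `M_x(τ, σ) = E_x[L_τ 1_{τ < σ} + U_σ 1_{σ ≤ τ}]`; the process started
at `x` is `x + X`. -/
noncomputable def expectedPayoff {Ω : Type*} [MeasurableSpace Ω] (X : ℝ≥0 → Ω → ℝ)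
    (P : Measure Ω) (q α β K x : ℝ) (τ σ : Ω → WithTop ℝ≥0) : ℝ≥0∞ :=
  ∫⁻ ω, (if τ ω < σ ω then payoffL q α β (fun t => x + X t ω) (τ ω)
    else payoffU q α β K (fun t => x + X t ω) (σ ω)) ∂P

/-- First passage time `inf {t > 0 : y t > a}` of a path strictly above `a`; `∞` if there is
no such `t`. -/
noncomputable def firstPassageAbove (y : ℝ≥0 → ℝ) (a : ℝ) : WithTop ℝ≥0 :=
  sInf {t : WithTop ℝ≥0 | ∃ s : ℝ≥0, 0 < s ∧ a < y s ∧ t = s}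

/-- `(τ', σ')` is a saddle point, over stopping times of `𝓕`, of the game in which the first
player chooses `τ` to maximize `M τ σ` and the second one chooses `σ` to minimize it. -/
structure IsSaddlePoint {Ω : Type*} {m : MeasurableSpace Ω} (𝓕 : Filtration ℝ≥0 m)
    (M : (Ω → WithTop ℝ≥0) → (Ω → WithTop ℝ≥0) → ℝ≥0∞) (τ' σ' : Ω → WithTop ℝ≥0) : Prop where
  stopping_sup : IsStoppingTime 𝓕 τ'
  stopping_inf : IsStoppingTime 𝓕 σ'
  le_left : ∀ τ, IsStoppingTime 𝓕 τ → M τ σ' ≤ M τ' σ'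
  le_right : ∀ σ, IsStoppingTime 𝓕 σ → M τ' σ' ≤ M τ' σ

/-- The game has the value `v`: `sup_τ inf_σ M τ σ = v = inf_σ sup_τ M τ σ`. -/
def HasValue {Ω : Type*} {m : MeasurableSpace Ω} (𝓕 : Filtration ℝ≥0 m)
    (M : (Ω → WithTop ℝ≥0) → (Ω → WithTop ℝ≥0) → ℝ≥0∞) (v : ℝ≥0∞) : Prop :=
  (⨆ (τ) (_ : IsStoppingTime 𝓕 τ), ⨅ (σ) (_ : IsStoppingTime 𝓕 σ), M τ σ) = v ∧
    (⨅ (σ) (_ : IsStoppingTime 𝓕 σ), ⨆ (τ) (_ : IsStoppingTime 𝓕 τ), M τ σ) = v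

end ConvertibleBond

/-! The argument is pathwise. Since a coupon is collected at rate at least `α ≥ q K`, the discounted
value `e^{-qt} K` of the amount `K` plus the coupon accumulated up to `t` never falls below
`(1 - e^{-qt}) K + e^{-qt} K = K`, for any `t ∈ [0, ∞]`: `le_terminal_add_coupon`. Stopping at once
costs the minimizer `K ∨ e^x`, whatever the maximizer does.

Conversely let the maximizer use the first passage time above `log K`. If `K < e^x`, this time is
`0` by right-continuity of the path, so that the pay-off is `e^x` whatever the minimizer does. If
`e^x ≤ K`, then at the passage time the process is at least at `log K`
(`le_apply_of_firstPassageAbove_eq`), again by right-continuity. So, whoever stops first, the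
undiscounted terminal pay-off is at least `K`, and the first observation bounds the whole pay-off
below by `K`. Hence the maximizer secures `K ∨ e^x`, and both the saddle point and the value follow.
That the first passage time is a stopping time uses right-continuity of the paths and of the
filtration. -/

namespace ConvertibleBond

theorem firstPassageAbove_lt_iff {y : ℝ≥0 → ℝ} {a : ℝ} {u : WithTop ℝ≥0} :
    firstPassageAbove y a < u ↔ ∃ s : ℝ≥0, 0 < s ∧ a < y s ∧ (s : WithTop ℝ≥0) < u := by
  unfold firstPassageAbove
  rw [sInf_lt_iff]
  constructor
  · rintro ⟨_, ⟨s, h0, hs, rfl⟩, hu⟩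
    exact ⟨s, h0, hs, hu⟩
  · rintro ⟨s, h0, hs, hu⟩
    exact ⟨s, ⟨s, h0, hs, rfl⟩, hu⟩

theorem firstPassageAbove_eq_zero {y : ℝ≥0 → ℝ} {a : ℝ}
    (hy : ContinuousWithinAt y (Ici 0) 0) (h : a < y 0) : firstPassageAbove y a = 0 := by
  refine le_antisymm (le_of_forall_gt fun u hu => ?_) zero_le
  have hev : ∀ᶠ s in 𝓝[>] (0 : ℝ≥0), a < y s :=
    (hy.mono Ioi_subset_Ici_self).eventually_const_lt h
  obtain ⟨v, hv0, hvu⟩ : ∃ v : ℝ≥0, 0 < v ∧ (v : WithTop ℝ≥0) ≤ u := by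
    cases u with
    | top => exact ⟨1, one_pos, le_top⟩
    | coe v => exact ⟨v, by exact_mod_cast hu, le_rfl⟩
  obtain ⟨s, hs, h0, hsv⟩ := (hev.and (Ioo_mem_nhdsGT hv0)).exists
  exact firstPassageAbove_lt_iff.2 ⟨s, h0, hs, lt_of_lt_of_le (by exact_mod_cast hsv) hvu⟩

theorem le_apply_of_firstPassageAbove_eq {y : ℝ≥0 → ℝ} {a : ℝ} {t : ℝ≥0}
    (hy : ContinuousWithinAt y (Ici t) t) (h : firstPassageAbove y a = t) : a ≤ y t := by
  by_contra! hlt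
  have hev : ∀ᶠ s in 𝓝[≥] t, y s < a := hy.eventually_lt_const hlt
  obtain ⟨u, htu, hu⟩ := (mem_nhdsGE_iff_exists_Ico_subset).1 hev
  have htu' : firstPassageAbove y a < (u : WithTop ℝ≥0) := by
    rw [h]; exact_mod_cast htu
  obtain ⟨s, h0, hs, hsu⟩ := firstPassageAbove_lt_iff.1 htu'
  have hts : t ≤ s := by
    by_contra! hst
    have : firstPassageAbove y a < t :=
      firstPassageAbove_lt_iff.2 ⟨s, h0, hs, by exact_mod_cast hst⟩
    exact this.ne h
  exact lt_asymm hs (hu ⟨hts, by exact_mod_cast hsu⟩)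

theorem isStoppingTime_firstPassageAbove {Ω : Type*} [MeasurableSpace Ω] {P : Measure Ω}
    {X : ℝ≥0 → Ω → ℝ} (hX : ∀ t, Measurable (X t))
    (hrc : ∀ ω t, ContinuousWithinAt (fun s => X s ω) (Ici t) t) (x a : ℝ) :
    IsStoppingTime (naturalEnlargement X hX P)
      fun ω => firstPassageAbove (fun t => x + X t ω) a := by
  unfold naturalEnlargement
  refine isStoppingTime_of_measurableSet_lt_of_isRightContinuous fun u => ?_
  refine Filtration.le_rightCont _ u _ ?_
  obtain ⟨D, hDc, hDd⟩ := TopologicalSpace.exists_countable_dense ℝ≥0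
  -- By right-continuity, a level exceeded before `u` is exceeded at a time of the dense set `D`.
  have hset : {ω | firstPassageAbove (fun t => x + X t ω) a < (u : WithTop ℝ≥0)} =
      ⋃ s ∈ D ∩ Ioo 0 u, {ω | a < x + X s ω} := by
    ext ω
    simp only [mem_ofPred_eq, firstPassageAbove_lt_iff, mem_iUnion, exists_prop]
    constructor
    · rintro ⟨s, h0, hs, hsu⟩
      have hsu' : s < u := by exact_mod_cast hsu
      have hev : ∀ᶠ r in 𝓝[≥] s, a < x + X r ω :=
        ((hrc ω s).const_add x).eventually_const_lt hs
      obtain ⟨v, hsv, hv⟩ := (mem_nhdsGE_iff_exists_Ico_subset' hsu').1 hev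
      obtain ⟨r, hrD, hr⟩ := hDd.exists_between (lt_min (mem_Ioi.1 hsv) hsu')
      exact ⟨r, ⟨hrD, h0.trans hr.1, hr.2.trans_le (min_le_right _ _)⟩,
        hv ⟨hr.1.le, hr.2.trans_le (min_le_left _ _)⟩⟩
    · rintro ⟨s, ⟨_, h0, hsu⟩, hs⟩
      exact ⟨s, h0, hs, by exact_mod_cast hsu⟩
  rw [hset]
  refine MeasurableSet.biUnion (hDc.mono inter_subset_left) fun s hs => ?_
  have hle : rawSigma X u ≤ regularizedFiltration X hX P u := le_sup_left
  refine hle _ ?_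
  have hcomap : MeasurableSpace.comap (X s) inferInstance ≤ rawSigma X u :=
    le_iSup₂_of_le (f := fun (s : ℝ≥0) (_ : s ≤ u) => MeasurableSpace.comap (X s) inferInstance)
      s hs.2.2.le le_rfl
  exact hcomap _ ⟨{z | a < x + z}, measurableSet_lt measurable_const (by fun_prop), rfl⟩

theorem coupon_zero (q α β : ℝ) (y : ℝ≥0 → ℝ) : coupon q α β y 0 = 0 := by
  have h : {s : ℝ | 0 ≤ s ∧ (s.toNNReal : WithTop ℝ≥0) ≤ 0} ⊆ {0} := fun s hs =>
    le_antisymm (Real.toNNReal_eq_zero.1 (nonpos_iff_eq_zero.1 (WithTop.coe_le_coe.1 hs.2))) hs.1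
  exact setLIntegral_measure_zero _ _ (measure_mono_null h (by simp))

theorem terminal_zero (q : ℝ) (g : ℝ → ℝ) (y : ℝ≥0 → ℝ) :
    terminal q g y 0 = ENNReal.ofReal (g (y 0)) := by
  change ENNReal.ofReal (Real.exp (-q * (0 : ℝ≥0)) * g (y 0)) = _
  simp

/-- The coupon dominates `K` times the mass that the exponential distribution of rate `q` gives
to `[0, t]`. -/
theorem lintegral_exponentialPDF_le_coupon {q α β K : ℝ} (hβ : 0 ≤ β) (hK : 0 ≤ K)
    (hqK : q * K ≤ α) (y : ℝ≥0 → ℝ) {t : WithTop ℝ≥0} {A : Set ℝ} (hA : MeasurableSet A)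
    (hAt : ∀ s ∈ A, 0 ≤ s → (s.toNNReal : WithTop ℝ≥0) ≤ t) :
    ENNReal.ofReal K * ∫⁻ s in A, exponentialPDF q s ≤ coupon q α β y t := by
  have hI : ∫⁻ s in A ∩ Ici 0, exponentialPDF q s = ∫⁻ s in A, exponentialPDF q s := by
    rw [← lintegral_indicator (hA.inter measurableSet_Ici), ← lintegral_indicator hA]
    refine lintegral_congr fun s => ?_
    rcases le_or_gt 0 s with h | h
    · have hs : s ∈ A ∩ Ici 0 ↔ s ∈ A := and_iff_left h
      by_cases hsA : s ∈ A
      · rw [indicator_of_mem hsA, indicator_of_mem (hs.2 hsA)]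
      · rw [indicator_of_notMem hsA, indicator_of_notMem (mt hs.1 hsA)]
    · rw [indicator_apply_eq_zero.2 fun _ => exponentialPDF_of_neg h,
        indicator_apply_eq_zero.2 fun _ => exponentialPDF_of_neg h]
  rw [← hI, ← lintegral_const_mul' _ _ ENNReal.ofReal_ne_top, coupon]
  calc
    _ ≤ ∫⁻ s in A ∩ Ici 0,
        ENNReal.ofReal (Real.exp (-q * s) * (α + β * Real.exp (y s.toNNReal))) := by
      refine setLIntegral_mono' (hA.inter measurableSet_Ici) fun s hs => ?_
      rw [exponentialPDF_of_nonneg hs.2, ← ENNReal.ofReal_mul hK]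
      refine ENNReal.ofReal_le_ofReal ?_
      have h1 : 0 ≤ β * Real.exp (y s.toNNReal) := by positivity
      calc K * (q * Real.exp (-(q * s))) = Real.exp (-q * s) * (q * K) := by
            rw [neg_mul]; ring
        _ ≤ _ := by gcongr; linarith
    _ ≤ _ := by
      refine lintegral_mono_set ?_
      exact fun s hs => ⟨hs.2, hAt s hs.1 hs.2⟩

theorem le_coupon_top {q α β K : ℝ} (hq : 0 < q) (hβ : 0 ≤ β) (hK : 0 ≤ K)
    (hqK : q * K ≤ α) (y : ℝ≥0 → ℝ) : ENNReal.ofReal K ≤ coupon q α β y ⊤ := by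
  simpa [lintegral_exponentialPDF_eq_one hq] using
    lintegral_exponentialPDF_le_coupon hβ hK hqK y (t := ⊤) MeasurableSet.univ
      fun _ _ _ => le_top

theorem le_coupon_coe {q α β K : ℝ} (hq : 0 < q) (hβ : 0 ≤ β) (hK : 0 ≤ K)
    (hqK : q * K ≤ α) (y : ℝ≥0 → ℝ) (t : ℝ≥0) :
    ENNReal.ofReal (K * (1 - Real.exp (-q * t))) ≤ coupon q α β y t := by
  have h := lintegral_exponentialPDF_le_coupon (q := q) hβ hK hqK y (t := (t : WithTop ℝ≥0))
    (measurableSet_Iic (a := (t : ℝ))) fun s hs _ =>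
      by exact_mod_cast Real.toNNReal_le_iff_le_coe.2 hs
  rwa [lintegral_exponentialPDF_eq_antiDeriv hq, if_pos t.coe_nonneg, ← ENNReal.ofReal_mul hK,
    ← neg_mul] at h

/-- A coupon rate of at least `q K` makes up for the discounting of a terminal pay-off of at
least `K`. At `t = ∞` the coupon alone is worth `K`. -/
theorem le_terminal_add_coupon {q α β K : ℝ} (hq : 0 < q) (hβ : 0 ≤ β) (hK : 0 ≤ K)
    (hqK : q * K ≤ α) {g : ℝ → ℝ} {y : ℝ≥0 → ℝ} {t : WithTop ℝ≥0}
    (hg : ∀ s : ℝ≥0, t = s → K ≤ g (y s)) :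
    ENNReal.ofReal K ≤ terminal q g y t + coupon q α β y t := by
  cases t with
  | top => exact (le_coupon_top hq hβ hK hqK y).trans le_add_self
  | coe t =>
    have hexp : Real.exp (-q * t) ≤ 1 :=
      Real.exp_le_one_iff.2 (by nlinarith [t.2])
    calc ENNReal.ofReal K
        = ENNReal.ofReal (Real.exp (-q * t) * K) +
            ENNReal.ofReal (K * (1 - Real.exp (-q * t))) := by
          rw [← ENNReal.ofReal_add (by positivity) (mul_nonneg hK (by linarith))]
          ring_nf
      _ ≤ _ := by
          refine add_le_add (ENNReal.ofReal_le_ofReal ?_) (le_coupon_coe hq hβ hK hqK y t)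
          exact mul_le_mul_of_nonneg_left (hg t rfl) (Real.exp_pos _).le

theorem payoffL_zero (q α β : ℝ) (y : ℝ≥0 → ℝ) :
    payoffL q α β y 0 = ENNReal.ofReal (Real.exp (y 0)) := by
  rw [payoffL, terminal_zero, coupon_zero, add_zero]

theorem payoffU_zero (q α β K : ℝ) (y : ℝ≥0 → ℝ) :
    payoffU q α β K y 0 = ENNReal.ofReal (max (Real.exp (y 0)) K) := by
  rw [payoffU, terminal_zero, coupon_zero, add_zero]

open Classical in
/-- Along every right-continuous path, stopping at the first passage above `log K` secures the
maximizer the amount `K ∨ e^{y 0}`, whenever the minimizer stops. -/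
theorem le_payoff_firstPassageAbove {q α β K : ℝ} (hq : 0 < q) (hβ : 0 ≤ β) (hK : 0 < K)
    (hqK : q * K ≤ α) {y : ℝ≥0 → ℝ} (hy : ∀ t, ContinuousWithinAt y (Ici t) t)
    (σ : WithTop ℝ≥0) :
    ENNReal.ofReal (max K (Real.exp (y 0))) ≤
      if firstPassageAbove y (Real.log K) < σ
        then payoffL q α β y (firstPassageAbove y (Real.log K)) else payoffU q α β K y σ := by
  rcases lt_or_ge (Real.log K) (y 0) with h | h
  · have hmax : max K (Real.exp (y 0)) = Real.exp (y 0) :=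
      max_eq_right ((Real.log_lt_iff_lt_exp hK).1 h).le
    rw [firstPassageAbove_eq_zero (hy 0) h, hmax]
    split_ifs with hσ
    · rw [payoffL_zero]
    · rw [nonpos_iff_eq_zero.1 (not_lt.1 hσ), payoffU_zero]
      exact ENNReal.ofReal_le_ofReal (le_max_left _ _)
  · rw [max_eq_left ((Real.le_log_iff_exp_le hK).1 h)]
    split_ifs with hσ
    · exact le_terminal_add_coupon hq hβ hK.le hqK fun s hs =>
        (Real.log_le_iff_le_exp hK).1 (le_apply_of_firstPassageAbove_eq (hy s) hs)
    · exact le_terminal_add_coupon hq hβ hK.le hqK fun _ _ => le_max_right _ _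

theorem expectedPayoff_zero {Ω : Type*} [MeasurableSpace Ω] {P : Measure Ω}
    [IsProbabilityMeasure P] {X : ℝ≥0 → Ω → ℝ} (h0 : ∀ᵐ ω ∂P, X 0 ω = 0) (q α β K x : ℝ)
    (τ : Ω → WithTop ℝ≥0) :
    expectedPayoff X P q α β K x τ (fun _ => 0) = ENNReal.ofReal (max K (Real.exp x)) := by
  have h : ∀ᵐ ω ∂P, payoffU q α β K (fun t => x + X t ω) 0 =
      ENNReal.ofReal (max K (Real.exp x)) := by
    filter_upwards [h0] with ω hω
    rw [payoffU_zero, hω, add_zero, max_comm]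
  simp [expectedPayoff, lintegral_congr_ae h]

theorem le_expectedPayoff_firstPassageAbove {Ω : Type*} [MeasurableSpace Ω] {P : Measure Ω}
    [IsProbabilityMeasure P] {X : ℝ≥0 → Ω → ℝ} (hX : IsLevyProcess X P) {q α β K : ℝ}
    (hq : 0 < q) (hβ : 0 ≤ β) (hK : 0 < K) (hqK : q * K ≤ α) (x : ℝ) (σ : Ω → WithTop ℝ≥0) :
    ENNReal.ofReal (max K (Real.exp x)) ≤ expectedPayoff X P q α β K x
      (fun ω => firstPassageAbove (fun t => x + X t ω) (Real.log K)) σ := by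
  calc ENNReal.ofReal (max K (Real.exp x))
      = ∫⁻ _, ENNReal.ofReal (max K (Real.exp x)) ∂P := by simp
    _ ≤ _ := by
      refine lintegral_mono_ae ?_
      filter_upwards [hX.zero] with ω hω
      have h := le_payoff_firstPassageAbove hq hβ hK hqK
        (fun t => (hX.right_continuous ω t).const_add x) (σ ω)
      rwa [hω, add_zero] at h

/-- If some `σ'` holds the maximizer to exactly `v` and some `τ'` secures the maximizer `v`, then
`(τ', σ')` is a saddle point and `v` is the value. -/
theorem isSaddlePoint_and_hasValue {Ω : Type*} {m : MeasurableSpace Ω} {𝓕 : Filtration ℝ≥0 m}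
    {M : (Ω → WithTop ℝ≥0) → (Ω → WithTop ℝ≥0) → ℝ≥0∞} {τ' σ' : Ω → WithTop ℝ≥0} {v : ℝ≥0∞}
    (hτ' : IsStoppingTime 𝓕 τ') (hσ' : IsStoppingTime 𝓕 σ')
    (hle : ∀ τ, IsStoppingTime 𝓕 τ → M τ σ' ≤ v)
    (hge : ∀ σ, IsStoppingTime 𝓕 σ → v ≤ M τ' σ) :
    IsSaddlePoint 𝓕 M τ' σ' ∧ HasValue 𝓕 M v := by
  have hlow : v ≤ ⨆ (τ) (_ : IsStoppingTime 𝓕 τ), ⨅ (σ) (_ : IsStoppingTime 𝓕 σ), M τ σ :=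
    le_iSup₂_of_le τ' hτ' (le_iInf₂ hge)
  have hup : (⨅ (σ) (_ : IsStoppingTime 𝓕 σ), ⨆ (τ) (_ : IsStoppingTime 𝓕 τ), M τ σ) ≤ v :=
    iInf₂_le_of_le σ' hσ' (iSup₂_le hle)
  refine ⟨⟨hτ', hσ', fun τ hτ => (hle τ hτ).trans (hge σ' hσ'),
    fun σ hσ => (hle τ' hτ').trans (hge σ hσ)⟩, le_antisymm ?_ hlow, le_antisymm hup ?_⟩
  · exact iSup₂_le fun τ hτ => (iInf₂_le σ' hσ').trans (hle τ hτ)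
  · exact le_iInf₂ fun σ hσ => (hge σ hσ).trans (le_iSup₂ (f := fun τ _ => M τ σ) τ' hτ')

end ConvertibleBond

theorem theorem2p1 {Ω : Type*} [MeasurableSpace Ω] (P : Measure Ω) [IsProbabilityMeasure P]
    (X : ℝ≥0 → Ω → ℝ) (hX : ConvertibleBond.IsSpectrallyPositive X P)
    (α β q K : ℝ) (hα : 0 ≤ α) (hβ : 0 < β) (hq : 0 < q) (hK : 0 < K)
    (hA : ConvertibleBond.laplaceExponent X P (-1) < (q : EReal))
    (hqK : q ≤ α / K) (x : ℝ) :
    ConvertibleBond.IsSaddlePoint (ConvertibleBond.naturalEnlargement X hX.measurable P)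
        (ConvertibleBond.expectedPayoff X P q α β K x)
        (fun ω => ConvertibleBond.firstPassageAbove (fun t => x + X t ω) (Real.log K))
        (fun _ => 0) ∧
      ConvertibleBond.HasValue (ConvertibleBond.naturalEnlargement X hX.measurable P)
        (ConvertibleBond.expectedPayoff X P q α β K x)
        (ENNReal.ofReal (max K (Real.exp x))) :=
  ConvertibleBond.isSaddlePoint_and_hasValue
    (ConvertibleBond.isStoppingTime_firstPassageAbove hX.measurable hX.right_continuous x _)
    (isStoppingTime_const _ 0)
    (fun τ _ => (ConvertibleBond.expectedPayoff_zero hX.zero q α β K x τ).le)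
    (fun σ _ => ConvertibleBond.le_expectedPayoff_firstPassageAbove hX.toIsLevyProcess hq hβ.le hK
      ((le_div_iff₀ hK).1 hqK) x σ)
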